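/- Let $m\le n$, let $\mathcal{A}:\mathbb{R}^{m\times n}\to\mathbb{R}^{d}$ be a linear map, $b\in\mathbb{R}^{d}$, and $a>1$. For $X\in\mathbb{R}^{m\times n}$ with singular values $\sigma_1(X)\ge\dots\ge\sigma_m(X)\ge 0$ put $$P_a(X)=\sum_{i=1}^{m}\frac{a\,\sigma_i(X)}{a\,\sigma_i(X)+1}.$$ For an integer $r\ge 1$ let $\delta_r(\mathcal{A})$ be the smallest number $\delta$ such that $$(1-\delta)\|X\|_F^2\le\|\mathcal{A}(X)\|_2^2\le(1+\delta)\|X\|_F^2$$ for all $X\in\mathbb{R}^{m\times n}$ of rank at most $r$. Let $X_0$ be an optimal solution of the problem (AMRM) of minimizing $\mathrm{rank}(X)$ subject to $\mathcal{A}(X)=b$, and let $X^{\ast}$ be an optimal solution of the problem (TrAMRM) of minimizing $P_a(X)$ subject to $\mathcal{A}(X)=b$. Suppose that $T=\mathrm{rank}(X_0)\ge 1$ and $$\delta_{5T}(\mathcal{A})<\frac{3-2a^{2}}{3+2a^{2}}.$$ Then $X^{\ast}=X_0$. -/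

import Mathlib

namespace AffineRank

/-- The `i`-th singular value of a real `m × n` matrix, in descending order and counted from
`i = 0`; it is `0` for `i ≥ min m n`. -/
noncomputable def singularValue {m n : ℕ} (X : Matrix (Fin m) (Fin n) ℝ) (i : ℕ) : ℝ :=
  (Matrix.toEuclideanLin X).singularValues i

/-- The fraction function `ρ_a(t) = a|t| / (a|t| + 1)`. -/
noncomputable def fractionFun (a t : ℝ) : ℝ :=
  a * |t| / (a * |t| + 1)

/-- The penalty `P_a(X)`: the sum of `ρ_a` over the `m` singular values of `X`. -/
noncomputable def fractionPenalty {m n : ℕ} (a : ℝ) (X : Matrix (Fin m) (Fin n) ℝ) : ℝ :=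
  ∑ i : Fin m, fractionFun a (singularValue X i)

/-- `X` is an optimal solution of: minimize `rank X` subject to `𝒜 X = b`. -/
def IsAMRMSolution {m n d : ℕ}
    (A : Matrix (Fin m) (Fin n) ℝ →ₗ[ℝ] EuclideanSpace ℝ (Fin d))
    (b : EuclideanSpace ℝ (Fin d)) (X : Matrix (Fin m) (Fin n) ℝ) : Prop :=
  A X = b ∧ ∀ Y : Matrix (Fin m) (Fin n) ℝ, A Y = b → X.rank ≤ Y.rank

/-- `X` is an optimal solution of: minimize `P_a(X)` subject to `𝒜 X = b`. -/
def IsTrAMRMSolution {m n d : ℕ} (a : ℝ)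
    (A : Matrix (Fin m) (Fin n) ℝ →ₗ[ℝ] EuclideanSpace ℝ (Fin d))
    (b : EuclideanSpace ℝ (Fin d)) (X : Matrix (Fin m) (Fin n) ℝ) : Prop :=
  A X = b ∧ ∀ Y : Matrix (Fin m) (Fin n) ℝ, A Y = b → fractionPenalty a X ≤ fractionPenalty a Y

section RestrictedIsometry

open scoped Matrix.Norms.Frobenius

/-- `δ` satisfies both restricted isometry inequalities for all matrices of rank at most `r`;
the norm of a matrix is here the Frobenius norm. -/
def IsRestrictedIsometryBound {m n d : ℕ}
    (A : Matrix (Fin m) (Fin n) ℝ →ₗ[ℝ] EuclideanSpace ℝ (Fin d)) (r : ℕ) (δ : ℝ) : Prop :=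
  ∀ X : Matrix (Fin m) (Fin n) ℝ, X.rank ≤ r →
    (1 - δ) * ‖X‖ ^ 2 ≤ ‖A X‖ ^ 2 ∧ ‖A X‖ ^ 2 ≤ (1 + δ) * ‖X‖ ^ 2

/-- The `r`-restricted isometry constant `δ_r(𝒜)`, the smallest restricted isometry bound;
see `isLeast_restrictedIsometryConstant`. -/
noncomputable def restrictedIsometryConstant {m n d : ℕ}
    (A : Matrix (Fin m) (Fin n) ℝ →ₗ[ℝ] EuclideanSpace ℝ (Fin d)) (r : ℕ) : ℝ :=
  sInf {δ : ℝ | IsRestrictedIsometryBound A r δ}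

/-- The infimum is attained, so that the constant is the smallest bound. -/
theorem isLeast_restrictedIsometryConstant {m n d : ℕ} (hm : 1 ≤ m) (hn : 1 ≤ n)
    (A : Matrix (Fin m) (Fin n) ℝ →ₗ[ℝ] EuclideanSpace ℝ (Fin d)) (r : ℕ) (hr : 1 ≤ r) :
    IsLeast {δ : ℝ | IsRestrictedIsometryBound A r δ} (restrictedIsometryConstant A r) := by
  have hne : {δ : ℝ | IsRestrictedIsometryBound A r δ}.Nonempty := by
    obtain ⟨C, hC, h⟩ := SemilinearMapClass.bound_of_continuous A
      (LinearMap.continuous_of_finiteDimensional A)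
    refine ⟨1 + C ^ 2, fun X _ => ⟨?_, ?_⟩⟩
    · nlinarith [sq_nonneg ‖A X‖, mul_nonneg (sq_nonneg C) (sq_nonneg ‖X‖)]
    · have h2 := pow_le_pow_left₀ (norm_nonneg _) (h X) 2
      nlinarith [sq_nonneg ‖X‖]
  have hbdd : BddBelow {δ : ℝ | IsRestrictedIsometryBound A r δ} := by
    refine ⟨0, fun δ hδ => ?_⟩
    let E : Matrix (Fin m) (Fin n) ℝ :=
      Matrix.vecMulVec (fun _ => (1 : ℝ)) (fun _ => (1 : ℝ))
    have hE : E ≠ 0 := fun h => by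
      have := congrFun (congrFun h ⟨0, hm⟩) ⟨0, hn⟩
      simp [E, Matrix.vecMulVec_apply] at this
    have hE' : 0 < ‖E‖ ^ 2 := pow_pos (norm_pos_iff.mpr hE) 2
    obtain ⟨h1, h2⟩ := hδ E ((Matrix.rank_vecMulVec_le _ _).trans hr)
    nlinarith
  have hcl : IsClosed {δ : ℝ | IsRestrictedIsometryBound A r δ} := by
    simp only [IsRestrictedIsometryBound, Set.ofPred_forall, Set.ofPred_and]
    refine isClosed_iInter fun X => isClosed_iInter fun _ => IsClosed.inter ?_ ?_
    · exact isClosed_le (by fun_prop) continuous_const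
    · exact isClosed_le continuous_const (by fun_prop)
  exact ⟨hcl.csInf_mem hne hbdd, fun δ hδ => csInf_le hbdd hδ⟩

end RestrictedIsometry

end AffineRank

/-!
# Exact recovery of low rank matrices by minimizing the fraction penalty

Let `R = X* - X₀`, so that `𝒜 R = 0`, let `s` be the sequence of its singular values, and let `f`
be the penalty function `ρ_a`. Two facts link `s` to the optimality `P_a(X*) ≤ P_a(X₀)`, with
`uᵢ = σᵢ(X₀) - σᵢ(X*)` for `i < T`.

* Since `X₀` has rank `T`, Weyl's inequality (`singularValues_add_le`) gives
  `s_{i+T} ≤ σᵢ(X*)`. Summing over the indices `i ≥ T` and using that `f` is subadditive,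
  `∑_{i ≥ 2T} f(sᵢ) ≤ ∑_{i < T} f(uᵢ)` (`sum_fractionFun_tail_le`).
* Mirsky's inequality (`sum_sq_singularValues_sub_le`), a consequence of von Neumann's trace
  inequality (`sum_inner_map_le`), gives `∑_{i < T} uᵢ² ≤ ‖R‖²`.

The singular value decomposition of `R` is cut into a head `H` with the indices below `5T` and
blocks `B₀, B₁, …` of `3T` indices each. The scale `τ = s_{5T-1}` serves to compare `f` with a linear
function: `f(t) / t` is nonincreasing, hence the first fact implies
`∑_{i ≥ 2T} min(sᵢ, τ) ≤ ∑_{i < T} max(|uᵢ|, τ)`. The left side bounds `√(3T) · S`, where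
`S = ∑ ‖B_j‖`, because each block is dominated by its predecessor. By Cauchy–Schwarz, the second
fact and `5Tτ² ≤ ‖H‖²`,
`3 S² ≤ ∑ uᵢ² + Tτ² ≤ (‖H‖² + S²) + ‖H‖² / 5`, that is, `S² ≤ (3/5) ‖H‖²` (`sq_sum_blocks_le`).

Finally `𝒜 H = -∑ 𝒜 B_j` and the restricted isometry bounds yield
`(1 - δ) ‖H‖² ≤ (1 + δ) S² ≤ (3/5) (1 + δ) ‖H‖²`, which forces `R = 0` as soon as `δ < 1/4`
(`eq_zero_of_isRestrictedIsometryBound`). For `a > 1` the hypothesis gives even `δ < 1/5`.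
-/

namespace AffineRank

open Finset Module

/-! ### The fraction function -/

theorem fractionFun_nonneg {a : ℝ} (ha : 0 < a) (t : ℝ) : 0 ≤ fractionFun a t := by
  unfold fractionFun; positivity

theorem fractionFun_zero (a : ℝ) : fractionFun a 0 = 0 := by simp [fractionFun]

theorem fractionFun_le_of_le {a x y : ℝ} (ha : 0 < a) (hx : 0 ≤ x) (hxy : x ≤ y) :
    fractionFun a x ≤ fractionFun a y := by
  unfold fractionFun
  rw [abs_of_nonneg hx, abs_of_nonneg (hx.trans hxy),
    div_le_div_iff₀ (by positivity) (by have := hx.trans hxy; positivity)]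
  nlinarith [mul_le_mul_of_nonneg_left hxy ha.le]

theorem fractionFun_sub_le {a x y : ℝ} (ha : 0 < a) (hx : 0 ≤ x) (hy : 0 ≤ y) :
    fractionFun a x - fractionFun a y ≤ fractionFun a (x - y) := by
  rcases le_total x y with h | h
  · linarith [fractionFun_le_of_le ha hx h, fractionFun_nonneg ha (x - y)]
  · have hd : 0 ≤ x - y := sub_nonneg.2 h
    unfold fractionFun
    rw [abs_of_nonneg hx, abs_of_nonneg hy, abs_of_nonneg hd]
    have e : a * x / (a * x + 1) - a * y / (a * y + 1)
        = a * (x - y) / ((a * x + 1) * (a * y + 1)) := by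
      field_simp
      ring
    rw [e]
    apply div_le_div_of_nonneg_left (by positivity) (by positivity)
    nlinarith [mul_nonneg ha.le hd, mul_nonneg ha.le hx, mul_nonneg ha.le hy,
      mul_nonneg (mul_nonneg ha.le hx) (mul_nonneg ha.le hy)]

/-- The quotient `ρ_a(t) / t` is nonincreasing. -/
theorem mul_fractionFun_le {a x y : ℝ} (ha : 0 < a) (hx : 0 ≤ x) (hxy : x ≤ y) :
    x * fractionFun a y ≤ y * fractionFun a x := by
  have hy := hx.trans hxy
  unfold fractionFun
  rw [abs_of_nonneg hx, abs_of_nonneg hy, ← mul_div_assoc, ← mul_div_assoc,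
    div_le_div_iff₀ (by positivity) (by positivity)]
  nlinarith [mul_le_mul_of_nonneg_left hxy (by positivity : 0 ≤ a * x * y * a)]

theorem mul_fractionFun_le_max_mul {a t : ℝ} (ha : 0 < a) (ht : 0 ≤ t) (u : ℝ) :
    t * fractionFun a u ≤ max |u| t * fractionFun a t := by
  have e : fractionFun a u = fractionFun a |u| := by simp [fractionFun]
  rw [e]
  rcases le_total |u| t with h | h
  · rw [max_eq_right h]
    exact mul_le_mul_of_nonneg_left (fractionFun_le_of_le ha (abs_nonneg u) h) ht
  · rw [max_eq_left h]
    exact mul_fractionFun_le ha ht h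

/-! ### Truncation and block estimates for sequences -/

theorem sum_range_mul_eq {M : Type*} [AddCommMonoid M] (g : ℕ → M) (K J : ℕ) :
    ∑ i ∈ range (K * J), g i = ∑ j ∈ range J, ∑ i ∈ range K, g (K * j + i) := by
  induction J with
  | zero => simp
  | succ J ih => rw [Nat.mul_succ, sum_range_add, ih, sum_range_succ]

/-- Truncation at the level `τ` turns the bound on the `ρ_a`-masses into a bound on sums. -/
theorem sum_min_le_sum_max {a τ : ℝ} (ha : 0 < a) (hτ : 0 < τ) {s u : ℕ → ℝ} (hs : ∀ i, 0 ≤ s i)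
    {N T : ℕ}
    (h : ∑ i ∈ range N, fractionFun a (s i) ≤ ∑ i ∈ range T, fractionFun a (u i)) :
    ∑ i ∈ range N, min (s i) τ ≤ ∑ i ∈ range T, max |u i| τ := by
  have hf : 0 < fractionFun a τ := by
    unfold fractionFun; rw [abs_of_pos hτ]; positivity
  refine le_of_mul_le_mul_right ?_ hf
  rw [sum_mul, sum_mul]
  calc ∑ i ∈ range N, min (s i) τ * fractionFun a τ
      ≤ ∑ i ∈ range N, τ * fractionFun a (s i) := by
        refine sum_le_sum fun i _ => ?_
        have h0 : 0 ≤ min (s i) τ := le_min (hs i) hτ.le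
        exact (mul_fractionFun_le ha h0 (min_le_right _ _)).trans
          (mul_le_mul_of_nonneg_left (fractionFun_le_of_le ha h0 (min_le_left _ _)) hτ.le)
    _ ≤ ∑ i ∈ range T, τ * fractionFun a (u i) := by
        rw [← mul_sum, ← mul_sum]
        exact mul_le_mul_of_nonneg_left h hτ.le
    _ ≤ _ := sum_le_sum fun i _ => mul_fractionFun_le_max_mul ha hτ.le (u i)

/-- The `ℓ²` norms of the blocks of length `3T` of `s` from the index `5T` on are controlled by the
sum of `s` truncated at `s (5T - 1)`: each block is compared with the preceding one. -/
theorem sqrt_mul_sum_sqrt_le {s : ℕ → ℝ} (hs : ∀ i, 0 ≤ s i) (hanti : Antitone s) {T : ℕ}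
    (hT : 1 ≤ T) (J : ℕ) :
    √(3 * T) * ∑ j ∈ range J, √(∑ i ∈ range (3 * T), s (5 * T + (3 * T * j + i)) ^ 2)
      ≤ ∑ i ∈ range (3 * T * J), min (s (2 * T + i)) (s (5 * T - 1)) := by
  rw [sum_range_mul_eq, mul_sum]
  refine sum_le_sum fun j _ => ?_
  set v := s (5 * T + 3 * T * j) with hv
  have h1 : ∑ i ∈ range (3 * T), s (5 * T + (3 * T * j + i)) ^ 2 ≤ (3 * T) * v ^ 2 := by
    calc _ ≤ ∑ i ∈ range (3 * T), v ^ 2 :=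
          sum_le_sum fun i _ => pow_le_pow_left₀ (hs _) (hanti (by omega)) 2
      _ = _ := by simp
  have h2 : (3 * T) * v
      ≤ ∑ i ∈ range (3 * T), min (s (2 * T + (3 * T * j + i))) (s (5 * T - 1)) := by
    calc (3 * T) * v = ∑ i ∈ range (3 * T), v := by simp
      _ ≤ _ := sum_le_sum fun i hi => by
          have := mem_range.1 hi
          exact le_min (hanti (by omega)) (hanti (by omega))
  refine le_trans ?_ h2
  have h3 := Real.sqrt_le_sqrt h1
  rw [Real.sqrt_mul (by positivity), Real.sqrt_sq (hs _)] at h3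
  calc _ ≤ √(3 * T) * (√(3 * T) * v) := mul_le_mul_of_nonneg_left h3 (Real.sqrt_nonneg _)
    _ = _ := by rw [← mul_assoc, Real.mul_self_sqrt (by positivity)]

/-- If the `ρ_a`-mass of `s` beyond the index `2T` is at most that of `u`, and the `ℓ²` norm of `u`
is at most that of `s`, then the sum of the `ℓ²` norms of the blocks of `s` beyond the index `5T` is
at most `√(3/5)` times the `ℓ²` norm of the part below `5T`. -/
theorem sq_sum_blocks_le {a : ℝ} (ha : 0 < a) {s u : ℕ → ℝ} (hs : ∀ i, 0 ≤ s i)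
    (hanti : Antitone s) {T : ℕ} (hT : 1 ≤ T) (J : ℕ)
    (hf : ∑ i ∈ range (3 * T * J), fractionFun a (s (2 * T + i))
      ≤ ∑ i ∈ range T, fractionFun a (u i))
    (hu : ∑ i ∈ range T, u i ^ 2 ≤ ∑ i ∈ range (5 * T + 3 * T * J), s i ^ 2) :
    (∑ j ∈ range J, √(∑ i ∈ range (3 * T), s (5 * T + (3 * T * j + i)) ^ 2)) ^ 2
      ≤ 3 / 5 * ∑ i ∈ range (5 * T), s i ^ 2 := by
  set τ := s (5 * T - 1) with hτdef
  set B : ℕ → ℝ := fun j => √(∑ i ∈ range (3 * T), s (5 * T + (3 * T * j + i)) ^ 2) with hB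
  set S := ∑ j ∈ range J, B j with hS
  have hS0 : 0 ≤ S := sum_nonneg fun j _ => Real.sqrt_nonneg _
  have hblock : √(3 * T) * S ≤ ∑ i ∈ range (3 * T * J), min (s (2 * T + i)) τ :=
    sqrt_mul_sum_sqrt_le hs hanti hT J
  have hTpos : (0 : ℝ) < T := by exact_mod_cast hT
  have hsq : 0 < √(3 * (T : ℝ)) := Real.sqrt_pos.2 (by positivity)
  rcases (hs (5 * T - 1)).eq_or_lt with h0 | h0
    -- if `τ = 0`, all blocks vanish
  · have : ∑ i ∈ range (3 * T * J), min (s (2 * T + i)) τ ≤ 0 :=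
      sum_nonpos fun i _ => (min_le_right _ _).trans h0.symm.le
    have hSz : S = 0 := by nlinarith
    rw [hSz]
    have : 0 ≤ ∑ i ∈ range (5 * T), s i ^ 2 := sum_nonneg fun i _ => sq_nonneg _
    nlinarith
  · have h1 := hblock.trans (sum_min_le_sum_max ha h0 (fun i => hs (2 * T + i)) hf)
    have h2 : (√(3 * T) * S) ^ 2 ≤ (∑ i ∈ range T, max |u i| τ) ^ 2 :=
      pow_le_pow_left₀ (by positivity) h1 2
    have h3 : (∑ i ∈ range T, max |u i| τ) ^ 2 ≤ T * ∑ i ∈ range T, max |u i| τ ^ 2 := by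
      simpa using sq_sum_le_card_mul_sum_sq (s := range T) (f := fun i => max |u i| τ)
    have h4 : ∑ i ∈ range T, max |u i| τ ^ 2 ≤ ∑ i ∈ range T, u i ^ 2 + T * τ ^ 2 := by
      calc _ ≤ ∑ i ∈ range T, (u i ^ 2 + τ ^ 2) := by
            refine sum_le_sum fun i _ => ?_
            rcases max_choice |u i| τ with h | h <;> rw [h]
            · rw [sq_abs]; nlinarith [sq_nonneg τ]
            · nlinarith [sq_nonneg (u i)]
        _ = _ := by simp [sum_add_distrib]
    have h5 : 5 * T * τ ^ 2 ≤ ∑ i ∈ range (5 * T), s i ^ 2 := by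
      calc 5 * T * τ ^ 2 = ∑ i ∈ range (5 * T), τ ^ 2 := by simp
        _ ≤ _ := sum_le_sum fun i hi => by
            have := mem_range.1 hi
            exact pow_le_pow_left₀ h0.le (hanti (by omega)) 2
    have h6 : ∑ i ∈ range (5 * T + 3 * T * J), s i ^ 2
        ≤ ∑ i ∈ range (5 * T), s i ^ 2 + S ^ 2 := by
      rw [sum_range_add, sum_range_mul_eq (fun i => s (5 * T + i) ^ 2)]
      gcongr
      calc _ = ∑ j ∈ range J, B j ^ 2 := sum_congr rfl fun j _ =>
            (Real.sq_sqrt (sum_nonneg fun i _ => sq_nonneg _)).symm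
        _ ≤ _ := sum_sq_le_sq_sum_of_nonneg fun j _ => Real.sqrt_nonneg _
    rw [mul_pow, Real.sq_sqrt (by positivity)] at h2
    have h7 : T * (3 * S ^ 2) ≤ T * (∑ i ∈ range T, u i ^ 2 + T * τ ^ 2) := by
      have := mul_le_mul_of_nonneg_left h4 hTpos.le
      nlinarith
    have h8 := le_of_mul_le_mul_left h7 hTpos
    linarith

/-! ### Doubly substochastic sums and Bessel's inequality -/

/-- Comparison of weighted sums by partial summation. -/
theorem sum_mul_le_sum_mul_of_sum_le {w x y : ℕ → ℝ} (hw : ∀ i, 0 ≤ w i) (hanti : Antitone w)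
    (h : ∀ k, ∑ i ∈ range k, x i ≤ ∑ i ∈ range k, y i) (n : ℕ) :
    ∑ i ∈ range n, w i * x i ≤ ∑ i ∈ range n, w i * y i := by
  -- the remainder term `w n * ∑ (y i - x i)` makes the induction work
  have key : w n * (∑ i ∈ range n, y i - ∑ i ∈ range n, x i)
      ≤ ∑ i ∈ range n, w i * y i - ∑ i ∈ range n, w i * x i := by
    induction n with
    | zero => simp
    | succ n ih =>
      have h1 := mul_le_mul_of_nonneg_right (hanti n.le_succ) (sub_nonneg.2 (h (n + 1)))
      simp only [sum_range_succ] at h1 ⊢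
      simp only [Nat.succ_eq_add_one] at h1
      linarith
  linarith [mul_nonneg (hw n) (sub_nonneg.2 (h n))]

/-- A doubly substochastic bilinear form of two nonincreasing sequences is at most their diagonal
sum. -/
theorem sum_substochastic_le {σ τ : ℕ → ℝ} (hσ : ∀ i, 0 ≤ σ i) (hσ' : Antitone σ)
    (hτ : ∀ i, 0 ≤ τ i) (hτ' : Antitone τ) {n : ℕ} {c : Fin n → Fin n → ℝ}
    (hc : ∀ i j, 0 ≤ c i j) (hrow : ∀ i, ∑ j, c i j ≤ 1) (hcol : ∀ j, ∑ i, c i j ≤ 1) :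
    ∑ i : Fin n, ∑ j : Fin n, σ i * τ j * c i j ≤ ∑ i ∈ range n, σ i * τ i := by
  -- `c` is extended by zero to `ℕ × ℕ`
  set c' : ℕ → ℕ → ℝ := fun i j => if h : i < n ∧ j < n then c ⟨i, h.1⟩ ⟨j, h.2⟩ else 0 with hc'
  have hc0 : ∀ i j, 0 ≤ c' i j := fun i j => by
    simp only [hc']; split_ifs
    exacts [hc _ _, le_rfl]
  have hcf : ∀ i j : Fin n, c' i j = c i j := fun i j => by simp [hc']
  have hrow' : ∀ k i, ∑ j ∈ range k, c' i j ≤ 1 := fun k i => by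
    by_cases hi : i < n
    · calc ∑ j ∈ range k, c' i j ≤ ∑ j ∈ range (max k n), c' i j :=
            sum_le_sum_of_subset_of_nonneg (range_mono (le_max_left _ _)) fun _ _ _ => hc0 _ _
        _ = ∑ j ∈ range n, c' i j :=
            (sum_subset (range_mono (le_max_right _ _)) fun j _ hj => by
              simp [hc', mem_range.not.1 hj]).symm
        _ = ∑ j : Fin n, c ⟨i, hi⟩ j := by
            rw [sum_range]; exact sum_congr rfl fun j _ => hcf ⟨i, hi⟩ j
        _ ≤ 1 := hrow _
    · simp [hc', hi]
  have hcol' : ∀ k j, ∑ i ∈ range k, c' i j ≤ 1 := fun k j => by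
    by_cases hj : j < n
    · calc ∑ i ∈ range k, c' i j ≤ ∑ i ∈ range (max k n), c' i j :=
            sum_le_sum_of_subset_of_nonneg (range_mono (le_max_left _ _)) fun _ _ _ => hc0 _ _
        _ = ∑ i ∈ range n, c' i j :=
            (sum_subset (range_mono (le_max_right _ _)) fun i _ hi => by
              simp [hc', mem_range.not.1 hi]).symm
        _ = ∑ i : Fin n, c i ⟨j, hj⟩ := by
            rw [sum_range]; exact sum_congr rfl fun i _ => hcf i ⟨j, hj⟩
        _ ≤ 1 := hcol _
    · simp [hc', hj]
  have hind : ∀ k l, ∑ i ∈ range k, ∑ j ∈ range l, c' i j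
      ≤ ∑ j ∈ range l, if j < k then (1 : ℝ) else 0 := fun k l => by
    have e : ∑ j ∈ range l, (if j < k then (1 : ℝ) else 0) = min (k : ℝ) l := by
      rw [← sum_filter]
      have : (range l).filter (· < k) = range (min k l) := by ext; simp; omega
      simp [this]
    rw [e]
    refine le_min ?_ ?_
    · exact (sum_le_sum fun i _ => hrow' l i).trans (by simp)
    · rw [sum_comm]
      exact (sum_le_sum fun j _ => hcol' k j).trans (by simp)
  have hpart : ∀ k, ∑ i ∈ range k, ∑ j ∈ range n, τ j * c' i j ≤ ∑ i ∈ range k, τ i := fun k => by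
    calc _ = ∑ j ∈ range n, τ j * ∑ i ∈ range k, c' i j := by
          rw [sum_comm]; simp only [mul_sum]
      _ ≤ ∑ j ∈ range n, τ j * (if j < k then 1 else 0) :=
          sum_mul_le_sum_mul_of_sum_le hτ hτ' (fun l => by
            rw [sum_comm]; exact hind k l) n
      _ = ∑ j ∈ (range n).filter (· < k), τ j := by simp [sum_filter]
      _ ≤ _ := sum_le_sum_of_subset_of_nonneg (fun j hj => mem_range.2 (mem_filter.1 hj).2)
          fun j _ _ => hτ j
  calc _ = ∑ i ∈ range n, σ i * ∑ j ∈ range n, τ j * c' i j := by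
        rw [sum_range]
        refine sum_congr rfl fun i _ => ?_
        rw [sum_range, mul_sum]
        exact sum_congr rfl fun j _ => by rw [hcf, mul_assoc]
    _ ≤ _ := sum_mul_le_sum_mul_of_sum_le hσ hσ' hpart n

/-- Bessel's inequality for an orthogonal family of vectors of norm at most one. -/
theorem sum_sq_inner_le_of_orthogonal {F : Type*} [NormedAddCommGroup F] [InnerProductSpace ℝ F]
    {ι : Type*} [Fintype ι] {q : ι → F}
    (horth : Pairwise fun i j => inner ℝ (q i) (q j) = 0) (hq : ∀ i, ‖q i‖ ≤ 1) (z : F) :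
    ∑ i, inner ℝ (q i) z ^ 2 ≤ ‖z‖ ^ 2 := by
  classical
  set w := ∑ i, inner ℝ (q i) z • q i with hw
  have h1 : inner ℝ z w = ∑ i, inner ℝ (q i) z ^ 2 := by
    simp only [hw, inner_sum, inner_smul_right]
    exact sum_congr rfl fun i _ => by rw [real_inner_comm]; ring
  have h2 : ‖w‖ ^ 2 ≤ ∑ i, inner ℝ (q i) z ^ 2 := by
    rw [← real_inner_self_eq_norm_sq, hw]
    simp only [sum_inner, inner_sum, inner_smul_left, inner_smul_right]
    refine sum_le_sum fun i _ => ?_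
    rw [sum_eq_single i (fun j _ hj => by rw [horth hj, mul_zero]) (by simp),
      real_inner_self_eq_norm_sq]
    have := pow_le_one₀ (norm_nonneg _) (hq i) (n := 2)
    simp only [conj_trivial]
    nlinarith [sq_nonneg (inner ℝ (q i) z : ℝ)]
  have h3 := norm_sub_sq_real z w
  nlinarith [sq_nonneg ‖z - w‖]

/-! ### Singular values of linear maps -/

section LinearMap

variable {E F : Type*} [NormedAddCommGroup E] [InnerProductSpace ℝ E] [FiniteDimensional ℝ E]
  [NormedAddCommGroup F] [InnerProductSpace ℝ F] [FiniteDimensional ℝ F]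

/-- There is an orthonormal basis of right singular vectors, in the order of the singular values. -/
theorem exists_basis_inner_map (X : E →ₗ[ℝ] F) {n : ℕ} (hn : finrank ℝ E = n) :
    ∃ b : OrthonormalBasis (Fin n) ℝ E, ∀ i j,
      inner ℝ (X (b i)) (X (b j)) = if i = j then X.singularValues i ^ 2 else 0 := by
  refine ⟨X.isSymmetric_adjoint_comp_self.eigenvectorBasis hn, fun i j => ?_⟩
  rw [← LinearMap.adjoint_inner_right, ← LinearMap.comp_apply,
    X.isSymmetric_adjoint_comp_self.apply_eigenvectorBasis hn, inner_smul_right,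
    OrthonormalBasis.inner_eq_ite, X.sq_singularValues_fin hn]
  split_ifs with h <;> simp [h]

theorem norm_sq_map_eq_sum {X : E →ₗ[ℝ] F} {n : ℕ} {b : OrthonormalBasis (Fin n) ℝ E}
    (hb : ∀ i j, inner ℝ (X (b i)) (X (b j)) = if i = j then X.singularValues i ^ 2 else 0)
    (v : E) : ‖X v‖ ^ 2 = ∑ i : Fin n, X.singularValues i ^ 2 * inner ℝ (b i) v ^ 2 := by
  rw [← real_inner_self_eq_norm_sq]
  conv_lhs => rw [← b.sum_repr' v]
  simp only [map_sum, map_smul, sum_inner, inner_sum, inner_smul_left, inner_smul_right, hb]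
  simp
  exact sum_congr rfl fun i _ => by ring

theorem norm_map_basis {X : E →ₗ[ℝ] F} {n : ℕ} {b : OrthonormalBasis (Fin n) ℝ E}
    (hb : ∀ i j, inner ℝ (X (b i)) (X (b j)) = if i = j then X.singularValues i ^ 2 else 0)
    (i : Fin n) : ‖X (b i)‖ = X.singularValues i := by
  have := hb i i
  rw [real_inner_self_eq_norm_sq, if_pos rfl] at this
  exact (pow_left_inj₀ (norm_nonneg _) (X.singularValues_nonneg i) two_ne_zero).1 this

/-- Weyl's inequality for a perturbation of low rank, by counting dimensions. -/
theorem singularValues_add_le (X Y : E →ₗ[ℝ] F) (i : ℕ) :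
    (X + Y).singularValues (i + finrank ℝ (LinearMap.range Y)) ≤ X.singularValues i := by
  set r := finrank ℝ (LinearMap.range Y) with hr
  rcases le_or_gt (finrank ℝ E) (i + r) with hN | hN
  · rw [LinearMap.singularValues_of_finrank_le _ hN]
    exact X.singularValues_nonneg i
  obtain ⟨n, hn⟩ : ∃ n, finrank ℝ E = n := ⟨_, rfl⟩
  rw [hn] at hN
  obtain ⟨b, hb⟩ := exists_basis_inner_map (X + Y) hn
  obtain ⟨p, hp⟩ := exists_basis_inner_map X hn
  -- some `v ≠ 0` lies in the kernel of `Y`, in the span of the first `i + r + 1` right singular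
  -- vectors of `X + Y`, and is orthogonal to the first `i` right singular vectors of `X`
  let L : E →ₗ[ℝ] LinearMap.range Y × ({k : Fin n // (k : ℕ) < i} → ℝ)
      × ({k : Fin n // i + r < (k : ℕ)} → ℝ) :=
    Y.rangeRestrict.prod ((LinearMap.pi fun k => innerₛₗ ℝ (p k.1)).prod
      (LinearMap.pi fun k => innerₛₗ ℝ (b k.1)))
  have hcard1 : Fintype.card {k : Fin n // (k : ℕ) < i} = i := by
    rw [Fintype.card_subtype]
    have := Fin.card_filter_val_lt (n := n) (m := i)
    omega
  have hcard2 : Fintype.card {k : Fin n // i + r < (k : ℕ)} = n - (i + r + 1) := by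
    have h1 : Fintype.card {k : Fin n // (k : ℕ) < i + r + 1} = i + r + 1 := by
      rw [Fintype.card_subtype]
      have := Fin.card_filter_val_lt (n := n) (m := i + r + 1)
      omega
    have h2 := Fintype.card_subtype_compl (fun k : Fin n => (k : ℕ) < i + r + 1)
    rw [h1, Fintype.card_fin] at h2
    rw [← h2]
    exact Fintype.card_congr (Equiv.subtypeEquivRight fun k => by omega)
  have hker : LinearMap.ker L ≠ ⊥ := by
    apply LinearMap.ker_ne_bot_of_finrank_lt
    rw [finrank_prod, finrank_prod, finrank_fintype_fun_eq_card, finrank_fintype_fun_eq_card,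
      hcard1, hcard2, hn, ← hr]
    omega
  obtain ⟨v, hv, hv0⟩ := Submodule.exists_mem_ne_zero_of_ne_bot hker
  have hL : L v = 0 := hv
  have hY : Y v = 0 := by
    have := congrArg (fun z => (z.1 : F)) hL
    simpa [L] using this
  have hpv : ∀ k : Fin n, (k : ℕ) < i → inner ℝ (p k) v = 0 := fun k hk => by
    have := congrFun (congrArg (fun z => z.2.1) hL) ⟨k, hk⟩
    simpa [L] using this
  have hbv : ∀ k : Fin n, i + r < (k : ℕ) → inner ℝ (b k) v = 0 := fun k hk => by
    have := congrFun (congrArg (fun z => z.2.2) hL) ⟨k, hk⟩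
    simpa [L] using this
  have hlow : (X + Y).singularValues (i + r) ^ 2 * ‖v‖ ^ 2 ≤ ‖(X + Y) v‖ ^ 2 := by
    rw [norm_sq_map_eq_sum hb, ← b.sum_sq_inner_right v, mul_sum]
    refine sum_le_sum fun k _ => ?_
    rcases le_or_gt (k : ℕ) (i + r) with hk | hk
    · exact mul_le_mul_of_nonneg_right (pow_le_pow_left₀ ((X + Y).singularValues_nonneg _)
        ((X + Y).singularValues_antitone hk) 2) (sq_nonneg _)
    · simp [hbv k hk]
  have hup : ‖X v‖ ^ 2 ≤ X.singularValues i ^ 2 * ‖v‖ ^ 2 := by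
    rw [norm_sq_map_eq_sum hp, ← p.sum_sq_inner_right v, mul_sum]
    refine sum_le_sum fun k _ => ?_
    rcases lt_or_ge (k : ℕ) i with hk | hk
    · simp [hpv k hk]
    · exact mul_le_mul_of_nonneg_right (pow_le_pow_left₀ (X.singularValues_nonneg _)
        (X.singularValues_antitone hk) 2) (sq_nonneg _)
  have hXY : (X + Y) v = X v := by simp [hY]
  rw [hXY] at hlow
  have hvpos : 0 < ‖v‖ ^ 2 := by positivity
  exact le_of_sq_le_sq (le_of_mul_le_mul_right (hlow.trans hup) hvpos) (X.singularValues_nonneg i)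

/-- The Hilbert–Schmidt norm does not depend on the orthonormal basis. -/
theorem sum_norm_sq_map_eq {ι κ : Type*} [Fintype ι] [Fintype κ] (X : E →ₗ[ℝ] F)
    (b : OrthonormalBasis ι ℝ E) (b' : OrthonormalBasis κ ℝ E) :
    ∑ i, ‖X (b i)‖ ^ 2 = ∑ i, ‖X (b' i)‖ ^ 2 := by
  calc ∑ i, ‖X (b i)‖ ^ 2
      = ∑ i, ∑ k, inner ℝ (stdOrthonormalBasis ℝ F k) (X (b i)) ^ 2 := by
        simp only [(stdOrthonormalBasis ℝ F).sum_sq_inner_right]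
    _ = ∑ k, ∑ i, inner ℝ (LinearMap.adjoint X (stdOrthonormalBasis ℝ F k)) (b i) ^ 2 := by
        simp only [LinearMap.adjoint_inner_left]
        exact sum_comm
    _ = ∑ k, ∑ i, inner ℝ (LinearMap.adjoint X (stdOrthonormalBasis ℝ F k)) (b' i) ^ 2 := by
        simp only [OrthonormalBasis.sum_sq_inner_left]
    _ = ∑ i, ∑ k, inner ℝ (stdOrthonormalBasis ℝ F k) (X (b' i)) ^ 2 := by
        simp only [LinearMap.adjoint_inner_left]
        exact sum_comm
    _ = _ := by simp only [(stdOrthonormalBasis ℝ F).sum_sq_inner_right]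

/-- A singular value decomposition in which the left singular vectors belonging to the singular
value `0` are replaced by `0`. -/
theorem exists_left_vectors {X : E →ₗ[ℝ] F} {n : ℕ} {b : OrthonormalBasis (Fin n) ℝ E}
    (hb : ∀ i j, inner ℝ (X (b i)) (X (b j)) = if i = j then X.singularValues i ^ 2 else 0) :
    ∃ q : Fin n → F, (∀ i, X (b i) = X.singularValues i • q i) ∧ (∀ i, ‖q i‖ ≤ 1) ∧
      Pairwise fun i j => inner ℝ (q i) (q j) = 0 := by
  refine ⟨fun i => (X.singularValues i)⁻¹ • X (b i), fun i => ?_, fun i => ?_, fun i j hij => ?_⟩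
  · rcases eq_or_ne (X.singularValues i) 0 with h | h
    · rw [h, zero_smul, ← norm_eq_zero, norm_map_basis hb, h]
    · rw [smul_inv_smul₀ h]
  · rw [norm_smul, norm_map_basis hb, norm_inv, Real.norm_of_nonneg (X.singularValues_nonneg i)]
    exact inv_mul_le_one
  · simp [inner_smul_left, inner_smul_right, hb, hij]

/-- Von Neumann's trace inequality. -/
theorem sum_inner_map_le (X Y : E →ₗ[ℝ] F) {ι : Type*} [Fintype ι] (b : OrthonormalBasis ι ℝ E)
    {n : ℕ} (hn : finrank ℝ E = n) :
    ∑ i, inner ℝ (X (b i)) (Y (b i)) ≤ ∑ i ∈ range n, X.singularValues i * Y.singularValues i := by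
  obtain ⟨u, hu⟩ := exists_basis_inner_map X hn
  obtain ⟨v, hv⟩ := exists_basis_inner_map Y hn
  obtain ⟨p, hXp, hp1, hp⟩ := exists_left_vectors hu
  obtain ⟨q, hYq, hq1, hq⟩ := exists_left_vectors hv
  set c : Fin n → Fin n → ℝ := fun i j => |inner ℝ (u i) (v j) * inner ℝ (p i) (q j)| with hc
  -- `c` is doubly substochastic by Bessel's inequality, as `|s t| ≤ (s² + t²) / 2`
  have hcle : ∀ i j, c i j ≤ (inner ℝ (u i) (v j) ^ 2 + inner ℝ (p i) (q j) ^ 2) / 2 := by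
    intro i j
    simp only [hc]
    rw [abs_le]
    constructor
    · nlinarith [sq_nonneg ((inner ℝ (u i) (v j) : ℝ) + inner ℝ (p i) (q j))]
    · nlinarith [sq_nonneg ((inner ℝ (u i) (v j) : ℝ) - inner ℝ (p i) (q j))]
  have hrow : ∀ i, ∑ j, c i j ≤ 1 := fun i => by
    refine (sum_le_sum fun j _ => hcle i j).trans ?_
    rw [← sum_div, sum_add_distrib, v.sum_sq_inner_left, u.orthonormal.1 i]
    have h1 := sum_sq_inner_le_of_orthogonal hq hq1 (p i)
    simp only [real_inner_comm (p i)] at h1 ⊢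
    have h2 := pow_le_one₀ (norm_nonneg _) (hp1 i) (n := 2)
    linarith
  have hcol : ∀ j, ∑ i, c i j ≤ 1 := fun j => by
    refine (sum_le_sum fun i _ => hcle i j).trans ?_
    rw [← sum_div, sum_add_distrib, u.sum_sq_inner_right, v.orthonormal.1 j]
    have h1 := sum_sq_inner_le_of_orthogonal hp hp1 (q j)
    have h2 := pow_le_one₀ (norm_nonneg _) (hq1 j) (n := 2)
    linarith
  refine le_trans ?_ (sum_substochastic_le X.singularValues_nonneg X.singularValues_antitone
    Y.singularValues_nonneg Y.singularValues_antitone (fun i j => abs_nonneg _) hrow hcol)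
  calc ∑ i, inner ℝ (X (b i)) (Y (b i))
      = ∑ k, inner ℝ (LinearMap.adjoint Y (X (b k))) (b k) := by
        simp only [LinearMap.adjoint_inner_left]
    _ = ∑ k, ∑ i, ∑ j, inner ℝ (b k) (u i) * inner ℝ (b k) (v j)
          * inner ℝ (X (u i)) (Y (v j)) := by
        refine sum_congr rfl fun k _ => ?_
        rw [LinearMap.adjoint_inner_left]
        have e1 : X (b k) = ∑ i, inner ℝ (u i) (b k) • X (u i) := by
          conv_lhs => rw [← u.sum_repr' (b k)]
          simp only [map_sum, map_smul]
        have e2 : Y (b k) = ∑ j, inner ℝ (v j) (b k) • Y (v j) := by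
          conv_lhs => rw [← v.sum_repr' (b k)]
          simp only [map_sum, map_smul]
        rw [e1, e2, sum_inner]
        simp only [inner_sum, inner_smul_left, inner_smul_right, conj_trivial]
        refine sum_congr rfl fun i _ => sum_congr rfl fun j _ => ?_
        rw [real_inner_comm (b k) (u i), real_inner_comm (b k) (v j)]
        ring
    _ = ∑ i, ∑ j, inner ℝ (u i) (v j) * inner ℝ (X (u i)) (Y (v j)) := by
        rw [sum_comm]
        refine sum_congr rfl fun i _ => ?_
        rw [sum_comm]
        refine sum_congr rfl fun j _ => ?_
        rw [← sum_mul, ← b.sum_inner_mul_inner (u i) (v j)]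
        simp only [real_inner_comm (u i)]
    _ ≤ _ := by
        refine sum_le_sum fun i _ => sum_le_sum fun j _ => ?_
        rw [hXp, hYq, inner_smul_left, inner_smul_right, conj_trivial]
        calc _ = X.singularValues i * Y.singularValues j
              * (inner ℝ (u i) (v j) * inner ℝ (p i) (q j)) := by ring
          _ ≤ _ := mul_le_mul_of_nonneg_left (le_abs_self _)
            (mul_nonneg (X.singularValues_nonneg _) (Y.singularValues_nonneg _))

theorem sum_norm_sq_map_eq_sum_singularValues (X : E →ₗ[ℝ] F) {ι : Type*} [Fintype ι]
    (b : OrthonormalBasis ι ℝ E) {n : ℕ} (hn : finrank ℝ E = n) :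
    ∑ i, ‖X (b i)‖ ^ 2 = ∑ i ∈ range n, X.singularValues i ^ 2 := by
  obtain ⟨u, hu⟩ := exists_basis_inner_map X hn
  rw [sum_norm_sq_map_eq X b u, sum_range]
  simp only [norm_map_basis hu]

/-- Mirsky's inequality for the Frobenius norm: expanding `‖X - Y‖²`, it is von Neumann's trace
inequality. -/
theorem sum_sq_singularValues_sub_le (X Y : E →ₗ[ℝ] F) (N : ℕ) {n : ℕ} (hn : finrank ℝ E = n) :
    ∑ i ∈ range N, (X.singularValues i - Y.singularValues i) ^ 2
      ≤ ∑ i ∈ range n, (X - Y).singularValues i ^ 2 := by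
  have b := (stdOrthonormalBasis ℝ E)
  have h1 := sum_inner_map_le X Y b hn
  have hX := sum_norm_sq_map_eq_sum_singularValues X b hn
  have hY := sum_norm_sq_map_eq_sum_singularValues Y b hn
  rw [← sum_norm_sq_map_eq_sum_singularValues (X - Y) b hn]
  simp only [LinearMap.sub_apply, norm_sub_sq_real, sum_add_distrib, sum_sub_distrib, ← mul_sum]
  rw [hX, hY]
  calc _ ≤ ∑ i ∈ range (max N n), (X.singularValues i - Y.singularValues i) ^ 2 :=
        sum_le_sum_of_subset_of_nonneg (range_mono (le_max_left _ _)) fun _ _ _ => sq_nonneg _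
    _ = ∑ i ∈ range n, (X.singularValues i - Y.singularValues i) ^ 2 :=
        (sum_subset (range_mono (le_max_right _ _)) fun i _ hi => by
          have : finrank ℝ E ≤ i := by simpa [hn] using hi
          simp [LinearMap.singularValues_of_finrank_le _ this]).symm
    _ ≤ _ := by
        simp only [sub_sq, sum_add_distrib, sum_sub_distrib, mul_assoc, ← mul_sum]
        linarith

end LinearMap

/-! ### Singular values of matrices -/

theorem finrank_range_toEuclideanLin {m n : ℕ} (X : Matrix (Fin m) (Fin n) ℝ) :
    finrank ℝ (LinearMap.range (Matrix.toEuclideanLin X)) = X.rank := by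
  rw [Matrix.toEuclideanLin, Matrix.toLpLin_eq_toLin, ← Matrix.rank_eq_finrank_range_toLin]

theorem singularValue_eq_zero_of_rank_le {m n : ℕ} {X : Matrix (Fin m) (Fin n) ℝ} {i : ℕ}
    (h : X.rank ≤ i) : singularValue X i = 0 :=
  (LinearMap.singularValues_eq_zero_iff_le_finrank_range _).2
    ((finrank_range_toEuclideanLin X).trans_le h)

theorem singularValue_nonneg {m n : ℕ} (X : Matrix (Fin m) (Fin n) ℝ) (i : ℕ) :
    0 ≤ singularValue X i :=
  LinearMap.singularValues_nonneg _ i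

theorem singularValue_antitone {m n : ℕ} (X : Matrix (Fin m) (Fin n) ℝ) :
    Antitone (singularValue X) :=
  LinearMap.singularValues_antitone _

theorem singularValue_add_rank_le {m n : ℕ} (X Y : Matrix (Fin m) (Fin n) ℝ) (i : ℕ) :
    singularValue (X - Y) (i + Y.rank) ≤ singularValue X i := by
  have := singularValues_add_le (Matrix.toEuclideanLin X) (-Matrix.toEuclideanLin Y) i
  rwa [LinearMap.range_neg, finrank_range_toEuclideanLin, ← sub_eq_add_neg, ← map_sub] at this

theorem sum_fractionFun_le_of_rank_le {a : ℝ} (ha : 0 < a) {m n : ℕ}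
    {X : Matrix (Fin m) (Fin n) ℝ} (N : ℕ) {M : ℕ} (hM : X.rank ≤ M) :
    ∑ i ∈ range N, fractionFun a (singularValue X i)
      ≤ ∑ i ∈ range M, fractionFun a (singularValue X i) := by
  refine (sum_le_sum_of_subset_of_nonneg (range_mono (le_max_left N M))
    fun _ _ _ => fractionFun_nonneg ha _).trans_eq
      (sum_subset (range_mono (le_max_right N M)) fun i _ hi => ?_).symm
  have hi' : M ≤ i := by simpa using hi
  rw [singularValue_eq_zero_of_rank_le (hM.trans hi'), fractionFun_zero]

theorem fractionPenalty_eq_sum_range (a : ℝ) {m n : ℕ} (X : Matrix (Fin m) (Fin n) ℝ) :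
    fractionPenalty a X = ∑ i ∈ range m, fractionFun a (singularValue X i) :=
  (sum_range (fun i => fractionFun a (singularValue X i))).symm

/-- The tail of the singular values of `X - X₀` has at most the `ρ_a`-mass of the changes of the
leading singular values. -/
theorem sum_fractionFun_tail_le {a : ℝ} (ha : 0 < a) {m n : ℕ} {X X₀ : Matrix (Fin m) (Fin n) ℝ}
    (h : fractionPenalty a X ≤ fractionPenalty a X₀) (N : ℕ) :
    ∑ i ∈ range N, fractionFun a (singularValue (X - X₀) (2 * X₀.rank + i))
      ≤ ∑ i ∈ range X₀.rank, fractionFun a (singularValue X₀ i - singularValue X i) := by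
  set T := X₀.rank with hT
  have h1 : ∑ i ∈ range N, fractionFun a (singularValue (X - X₀) (2 * T + i))
      ≤ ∑ i ∈ range N, fractionFun a (singularValue X (T + i)) :=
    sum_le_sum fun i _ => fractionFun_le_of_le ha (singularValue_nonneg _ _) (by
      have := singularValue_add_rank_le X X₀ (T + i)
      rwa [← hT, show T + i + T = 2 * T + i by ring] at this)
  have h2 := sum_fractionFun_le_of_rank_le ha (T + N) X.rank_le_height
  rw [sum_range_add] at h2
  have h3 := sum_fractionFun_le_of_rank_le ha m hT.ge
  simp only [fractionPenalty_eq_sum_range] at h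
  have h4 : ∑ i ∈ range T, (fractionFun a (singularValue X₀ i) - fractionFun a (singularValue X i))
      ≤ ∑ i ∈ range T, fractionFun a (singularValue X₀ i - singularValue X i) :=
    sum_le_sum fun i _ => fractionFun_sub_le ha (singularValue_nonneg _ _) (singularValue_nonneg _ _)
  rw [sum_sub_distrib] at h4
  linarith

theorem rank_add_le {m n : ℕ} (X Y : Matrix (Fin m) (Fin n) ℝ) :
    (X + Y).rank ≤ X.rank + Y.rank := by
  have h := LinearMap.range_add_le (Matrix.toEuclideanLin X) (Matrix.toEuclideanLin Y)
  rw [← map_add] at h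
  simp only [← finrank_range_toEuclideanLin]
  exact (Submodule.finrank_mono h).trans (Submodule.finrank_add_le_finrank_add_finrank _ _)

theorem toEuclideanLin_vecMulVec {m n : ℕ} (x : EuclideanSpace ℝ (Fin m))
    (y v : EuclideanSpace ℝ (Fin n)) :
    Matrix.toEuclideanLin (Matrix.vecMulVec x.ofLp y.ofLp) v = inner ℝ y v • x := by
  rw [Matrix.toLpLin_apply, Matrix.vecMulVec_mulVec, EuclideanSpace.inner_eq_star_dotProduct]
  ext i
  simp [dotProduct_comm, mul_comm]

/-! ### Frobenius norm and rank one decomposition -/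

open scoped Matrix.Norms.Frobenius

theorem frobenius_norm_sq_eq_sum {m n : ℕ} (X : Matrix (Fin m) (Fin n) ℝ)
    (b : OrthonormalBasis (Fin n) ℝ (EuclideanSpace ℝ (Fin n))) :
    ‖X‖ ^ 2 = ∑ j, ‖Matrix.toEuclideanLin X (b j)‖ ^ 2 := by
  rw [sum_norm_sq_map_eq _ b (EuclideanSpace.basisFun (Fin n) ℝ), Matrix.frobenius_norm_def,
    ← Real.sqrt_eq_rpow, Real.sq_sqrt (by positivity), sum_comm]
  refine sum_congr rfl fun j _ => ?_
  rw [EuclideanSpace.norm_sq_eq]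
  refine sum_congr rfl fun i _ => ?_
  simp [Matrix.toLpLin_apply]

/-- A singular value decomposition as a sum of matrices of rank at most one. They are indexed by `ℕ`
and vanish from the index `n` on, so that blocks of indices need no upper bound. -/
theorem exists_rank_one_decomposition {m n : ℕ} (X : Matrix (Fin m) (Fin n) ℝ) :
    ∃ E : ℕ → Matrix (Fin m) (Fin n) ℝ, (∀ N, n ≤ N → ∑ i ∈ range N, E i = X) ∧
      ∀ S : Finset ℕ, (∑ i ∈ S, E i).rank ≤ #S ∧
        ‖∑ i ∈ S, E i‖ ^ 2 = ∑ i ∈ S, singularValue X i ^ 2 := by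
  obtain ⟨b, hb⟩ := exists_basis_inner_map (Matrix.toEuclideanLin X)
    (finrank_euclideanSpace_fin (𝕜 := ℝ) (n := n))
  set E : ℕ → Matrix (Fin m) (Fin n) ℝ := fun i => if h : i < n then
    Matrix.vecMulVec (Matrix.toEuclideanLin X (b ⟨i, h⟩)).ofLp (b ⟨i, h⟩).ofLp else 0 with hE
  have happ : ∀ (i : ℕ) (j : Fin n), Matrix.toEuclideanLin (E i) (b j)
      = if i = j then Matrix.toEuclideanLin X (b j) else 0 := by
    intro i j
    simp only [hE]
    split_ifs with h1 h2 h2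
    · obtain rfl : j = ⟨i, h1⟩ := Fin.ext h2.symm
      rw [toEuclideanLin_vecMulVec, OrthonormalBasis.inner_eq_one, one_smul]
    · rw [toEuclideanLin_vecMulVec,
        OrthonormalBasis.inner_eq_zero _ fun h => h2 (congrArg Fin.val h), zero_smul]
    · omega
    · simp
  have hsum : ∀ (S : Finset ℕ) (j : Fin n), Matrix.toEuclideanLin (∑ i ∈ S, E i) (b j)
      = if (j : ℕ) ∈ S then Matrix.toEuclideanLin X (b j) else 0 := by
    intro S j
    simp [map_sum, LinearMap.sum_apply, happ]
  refine ⟨E, fun N hN => ?_, fun S => ⟨?_, ?_⟩⟩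
  · apply Matrix.toEuclideanLin.injective
    refine b.toBasis.ext fun j => ?_
    simp only [OrthonormalBasis.coe_toBasis, hsum]
    rw [if_pos (mem_range.2 (j.2.trans_le hN))]
  · have h1 : ∀ i, (E i).rank ≤ 1 := fun i => by
      simp only [hE]
      split_ifs
      · exact Matrix.rank_vecMulVec_le _ _
      · simp
    induction S using Finset.induction_on with
    | empty => simp
    | insert i S hi ih =>
      rw [sum_insert hi, card_insert_of_notMem hi]
      exact (rank_add_le _ _).trans (by have := h1 i; omega)
  · rw [frobenius_norm_sq_eq_sum _ b]
    calc _ = ∑ j : Fin n, if (j : ℕ) ∈ S then singularValue X j ^ 2 else 0 := by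
          refine sum_congr rfl fun j _ => ?_
          rw [hsum]
          split_ifs
          · rw [norm_map_basis hb]; rfl
          · simp
      _ = ∑ i ∈ range n, if i ∈ S then singularValue X i ^ 2 else 0 :=
          (sum_range (fun i => if i ∈ S then singularValue X i ^ 2 else 0)).symm
      _ = ∑ i ∈ S, if i < n then singularValue X i ^ 2 else 0 := by
          rw [← sum_filter, ← sum_filter]
          refine sum_congr ?_ fun _ _ => rfl
          ext; simp [and_comm]
      _ = _ := by
          refine sum_congr rfl fun i _ => ?_
          split_ifs with h
          · rfl
          · rw [singularValue_eq_zero_of_rank_le (X.rank_le_width.trans (not_lt.1 h))]; simp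

theorem sum_sq_singularValue_sub_le {m n : ℕ} (X Y : Matrix (Fin m) (Fin n) ℝ) (N : ℕ) {L : ℕ}
    (hL : n ≤ L) :
    ∑ i ∈ range N, (singularValue Y i - singularValue X i) ^ 2
      ≤ ∑ i ∈ range L, singularValue (X - Y) i ^ 2 := by
  have h := sum_sq_singularValues_sub_le (Matrix.toEuclideanLin X) (Matrix.toEuclideanLin Y) N
    (finrank_euclideanSpace_fin (𝕜 := ℝ) (n := n))
  rw [← map_sub] at h
  simp only [sub_sq_comm (Matrix.toEuclideanLin X |>.singularValues _)] at h
  exact h.trans (sum_le_sum_of_subset_of_nonneg (range_mono hL) fun _ _ _ => sq_nonneg _)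

/-! ### Restricted isometry bounds -/

theorem nonneg_of_isRestrictedIsometryBound {m n d : ℕ}
    {A : Matrix (Fin m) (Fin n) ℝ →ₗ[ℝ] EuclideanSpace ℝ (Fin d)} {r : ℕ} {δ : ℝ}
    (hA : IsRestrictedIsometryBound A r δ) {X : Matrix (Fin m) (Fin n) ℝ} (hX : X ≠ 0)
    (hr : X.rank ≤ r) : 0 ≤ δ := by
  have h := hA X hr
  have hpos : 0 < ‖X‖ ^ 2 := by positivity
  nlinarith [h.1.trans h.2]

/-- Under a restricted isometry bound `δ < 1 / 4` on matrices of rank `5T`, a matrix in the kernel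
of `A` vanishes if its singular values obey the block estimate. -/
theorem eq_zero_of_isRestrictedIsometryBound {m n d : ℕ}
    {A : Matrix (Fin m) (Fin n) ℝ →ₗ[ℝ] EuclideanSpace ℝ (Fin d)} {T : ℕ} {δ : ℝ}
    (hT : 1 ≤ T) (hA : IsRestrictedIsometryBound A (5 * T) δ) (hδ0 : 0 ≤ δ) (hδ : δ < 1 / 4)
    {R : Matrix (Fin m) (Fin n) ℝ} (hR : A R = 0)
    (h : (∑ j ∈ range n, √(∑ i ∈ range (3 * T), singularValue R (5 * T + (3 * T * j + i)) ^ 2)) ^ 2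
      ≤ 3 / 5 * ∑ i ∈ range (5 * T), singularValue R i ^ 2) : R = 0 := by
  obtain ⟨E, hsum, hE⟩ := exists_rank_one_decomposition R
  set H := ∑ i ∈ range (5 * T), E i with hH
  set B : ℕ → Matrix (Fin m) (Fin n) ℝ := fun j =>
    ∑ i ∈ range (3 * T), E (5 * T + (3 * T * j + i)) with hB
  have hdec : R = H + ∑ j ∈ range n, B j := by
    rw [← hsum (5 * T + 3 * T * n) (by nlinarith), sum_range_add,
      sum_range_mul_eq (fun i => E (5 * T + i))]
  have hBE : ∀ j, (B j).rank ≤ 5 * T ∧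
      ‖B j‖ = √(∑ i ∈ range (3 * T), singularValue R (5 * T + (3 * T * j + i)) ^ 2) := by
    intro j
    have := hE ((range (3 * T)).map (addLeftEmbedding (5 * T + 3 * T * j)))
    simp only [sum_map, card_map, card_range, addLeftEmbedding_apply, add_assoc] at this
    refine ⟨this.1.trans (by omega), ?_⟩
    rw [← this.2, Real.sqrt_sq (norm_nonneg _)]
  have hHE := hE (range (5 * T))
  rw [card_range, ← hH] at hHE
  rw [← hHE.2] at h
  simp only [← fun j => (hBE j).2] at h
  set S := ∑ j ∈ range n, ‖B j‖ with hS
  have hS0 : 0 ≤ S := sum_nonneg fun j _ => norm_nonneg _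
  have hAB : ∀ j, ‖A (B j)‖ ≤ √(1 + δ) * ‖B j‖ := fun j => by
    refine le_of_sq_le_sq ?_ (by positivity)
    rw [mul_pow, Real.sq_sqrt (by linarith)]
    exact (hA _ (hBE j).1).2
  have hAH : ‖A H‖ ≤ √(1 + δ) * S := by
    have e : A H = -∑ j ∈ range n, A (B j) := by
      rw [← map_sum, eq_neg_iff_add_eq_zero, ← map_add, ← hdec, hR]
    rw [e, norm_neg, hS, mul_sum]
    exact norm_sum_le_of_le _ fun j _ => hAB j
  have h1 := pow_le_pow_left₀ (norm_nonneg _) hAH 2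
  rw [mul_pow, Real.sq_sqrt (by linarith)] at h1
  have h2 := (hA H hHE.1).1
  have hH0 : ‖H‖ ^ 2 ≤ 0 := by
    have h3 : (1 + δ) * S ^ 2 ≤ (1 + δ) * (3 / 5 * ‖H‖ ^ 2) :=
      mul_le_mul_of_nonneg_left h (by linarith)
    nlinarith [sq_nonneg ‖H‖]
  have hHz : H = 0 := by
    rw [← norm_eq_zero]; exact pow_eq_zero_iff two_ne_zero |>.1 (le_antisymm hH0 (sq_nonneg _))
  have hSz : S = 0 :=
    pow_eq_zero_iff two_ne_zero |>.1 (le_antisymm (h.trans (by linarith)) (sq_nonneg _))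
  have hBz : ∀ j ∈ range n, B j = 0 := fun j hj =>
    norm_eq_zero.1 ((sum_eq_zero_iff_of_nonneg fun j _ => norm_nonneg (B j)).1 hSz j hj)
  rw [hdec, hHz, sum_eq_zero hBz, add_zero]

end AffineRank

theorem corollary3 {m n d : ℕ} (hmn : m ≤ n)
    (A : Matrix (Fin m) (Fin n) ℝ →ₗ[ℝ] EuclideanSpace ℝ (Fin d))
    (b : EuclideanSpace ℝ (Fin d)) (a : ℝ) (ha : 1 < a) (T : ℕ) (hT : 1 ≤ T)
    (Xstar X₀ : Matrix (Fin m) (Fin n) ℝ)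
    (hXstar : AffineRank.IsTrAMRMSolution a A b Xstar)
    (hX₀ : AffineRank.IsAMRMSolution A b X₀)
    (hrank : X₀.rank = T)
    (hδ : AffineRank.restrictedIsometryConstant A (5 * T) <
      (3 - 2 * a ^ 2) / (3 + 2 * a ^ 2)) :
    Xstar = X₀ := by
  have ha0 : 0 < a := by linarith
  have hm : 1 ≤ m := hT.trans (hrank ▸ X₀.rank_le_height)
  have hA := (AffineRank.isLeast_restrictedIsometryConstant hm (hm.trans hmn) A (5 * T)
    (by omega)).1
  set δ := AffineRank.restrictedIsometryConstant A (5 * T)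
  have hX₀ne : X₀ ≠ 0 := by
    rintro rfl
    rw [Matrix.rank_zero] at hrank
    omega
  have hδ0 : 0 ≤ δ := AffineRank.nonneg_of_isRestrictedIsometryBound hA hX₀ne (by omega)
  have hδ1 : δ < 1 / 4 := by
    refine hδ.trans ?_
    rw [div_lt_div_iff₀ (by positivity) (by norm_num)]
    nlinarith
  subst hrank
  refine sub_eq_zero.1 (AffineRank.eq_zero_of_isRestrictedIsometryBound hT hA hδ0 hδ1
    (by rw [map_sub, hXstar.1, hX₀.1, sub_self]) ?_)
  exact AffineRank.sq_sum_blocks_le ha0 (AffineRank.singularValue_nonneg _)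
    (AffineRank.singularValue_antitone _) hT n
    (AffineRank.sum_fractionFun_tail_le ha0 (hXstar.2 X₀ hX₀.1) _)
    (AffineRank.sum_sq_singularValue_sub_le _ _ _ (by nlinarith))
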